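/- Let $r,n\ge 0$ and $1\le k_1<k_2<\cdots<k_r\le n$ be integers. The projection flag variety is $$\mathrm{pFl}(\mathbf k;n)=\{(P_1,\ldots,P_r)\in \mathrm{Sym}(\mathbb C^n)^r : P_iP_j=P_j,\ \mathrm{trace}(P_i)=k_i \text{ for } 1\le j\le i\le r\},$$ where $\mathrm{Sym}(\mathbb C^n)$ is the space of complex symmetric $n\times n$ matrices. Let $P_1,\ldots,P_r$ also denote $n\times n$ symmetric matrices of unknowns, and let $\mathbb C[P_1,\ldots,P_r]$ be the polynomial ring in their $r\binom{n+1}{2}$ distinct entries. Then $\mathrm{pFl}(\mathbf k;n)$ is smooth over $\mathbb C$, and the ideal of all polynomials in $\mathbb C[P_1,\ldots,P_r]$ vanishing on $\mathrm{pFl}(\mathbf k;n)$ is prime and equals $$\langle P_iP_{i-1}-P_{i-1} : 2\le i\le r\rangle+\langle P_i^2-P_i,\ \mathrm{trace}(P_i)-k_i : 1\le i\le r\rangle,$$ where a matrix stands for all of its entries. -/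

import Mathlib

/-- The projection flag variety: tuples of complex symmetric `n × n` matrices with
`P_i P_j = P_j` for all `j ≤ i` and `trace P_i = k_i`. -/
def pFl {r : ℕ} (k : Fin r → ℕ) (n : ℕ) : Set (Fin r → Matrix (Fin n) (Fin n) ℂ) :=
  {P | (∀ i, (P i).IsSymm) ∧ (∀ i j, j ≤ i → P i * P j = P j) ∧
    ∀ i, (P i).trace = (k i : ℂ)}

/-- The index set of the coordinates on `Sym(ℂⁿ)^r`: one coordinate for each matrix `P_i` and each
unordered pair `{a, b}` of (possibly equal) positions. -/
abbrev SymVar (r n : ℕ) : Type := Fin r × Sym2 (Fin n)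

/-- The tuple of symmetric matrices with entries in `R` and given coordinates. -/
def symTuple {R : Type*} {r n : ℕ} (x : SymVar r n → R) (i : Fin r) : Matrix (Fin n) (Fin n) R :=
  Matrix.of fun a b => x (i, s(a, b))

/-- Taking coordinates identifies the affine space with `Sym(R^n)^r`. -/
theorem symTuple_bijOn {R : Type*} {r n : ℕ} :
    Set.BijOn (symTuple (R := R) (r := r) (n := n)) Set.univ {P | ∀ i, (P i).IsSymm} := by
  refine ⟨fun x _ i => ?_, fun x _ y _ h => ?_, fun P hP => ?_⟩
  · ext a b
    simp [symTuple, Sym2.eq_swap]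
  · funext ⟨i, e⟩
    induction e with
    | _ a b => exact congrFun (congrFun (congrFun h i) a) b
  · refine ⟨fun p => Sym2.lift ⟨fun a b => P p.1 a b, fun a b => (hP p.1).apply b a⟩ p.2,
      trivial, ?_⟩
    funext i
    ext a b
    simp [symTuple]

/-- The polynomial ring `ℂ[P_1, …, P_r]` in the entries of `r` symmetric `n × n` matrices. -/
abbrev SymRing (r n : ℕ) : Type := MvPolynomial (SymVar r n) ℂ

/-- The symmetric matrices of unknowns `P_1, …, P_r`. -/
noncomputable def genericSym (r n : ℕ) (i : Fin r) : Matrix (Fin n) (Fin n) (SymRing r n) :=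
  symTuple MvPolynomial.X i

/-- The projection flag variety as a subset of affine space, in the coordinates above. -/
def pFlPoints {r : ℕ} (k : Fin r → ℕ) (n : ℕ) : Set (SymVar r n → ℂ) :=
  {x | symTuple x ∈ pFl k n}

/-- The vanishing ideal of the projection flag variety in `ℂ[P_1, …, P_r]`. -/
noncomputable def pFlIdeal {r : ℕ} (k : Fin r → ℕ) (n : ℕ) : Ideal (SymRing r n) :=
  MvPolynomial.vanishingIdeal ℂ (pFlPoints k n)

/-- The coordinate ring of the projection flag variety. -/
abbrev pFlCoordRing {r : ℕ} (k : Fin r → ℕ) (n : ℕ) : Type :=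
  SymRing r n ⧸ pFlIdeal k n

/-- The ideal generated by the entries of `P_i P_{i-1} - P_{i-1}` for consecutive indices, the
entries of `P_i ^ 2 - P_i`, and `trace P_i - k_i`. -/
noncomputable def flagEquationsIdeal {r : ℕ} (k : Fin r → ℕ) (n : ℕ) : Ideal (SymRing r n) :=
  Ideal.span {f | ∃ i j : Fin r, (j : ℕ) + 1 = (i : ℕ) ∧ ∃ a b : Fin n,
      f = (genericSym r n i * genericSym r n j - genericSym r n j) a b} ⊔
    Ideal.span ({f | ∃ (i : Fin r) (a b : Fin n),
        f = (genericSym r n i ^ 2 - genericSym r n i) a b} ∪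
      {f | ∃ i : Fin r, f = (genericSym r n i).trace - MvPolynomial.C (k i : ℂ)})

/-! Write `A` for the quotient by the stated equations; algebra maps from `A` to `R` are projection
flags over `R` (`flagEquationsIdeal_le_ker_iff`).

Primality: over a local ring of characteristic zero, a flag is conjugate by some invertible `g` to
the standard diagonal one (`exists_mul_eq_mul_truncId`). Symmetry then forces `P_i` to be the
orthogonal projection onto the span of the first `k_i` columns of `g`, given by a Gram matrix
formula (`gramProj_eq_of_mul_eq`). The formula for a generic `g` defines a map `φ` from the
polynomial ring to a localization `L` of another polynomial ring, a domain. The tautological flag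
over each localization of `A` at a maximal ideal factors through `φ`, so anything killed by `φ` is
zero in `A`. Hence the equations generate the prime ideal `ker φ`, and the Nullstellensatz
identifies it with the vanishing ideal.

Smoothness: flags lift along square-zero extensions (`IsProjFlag.exists_lift`). The successive
differences of a flag are polynomials in one symmetric matrix `T`. Lift `T` to a symmetric `T'`,
lift the idempotents inside `ℂ[T']`, and note that the trace of an idempotent is rigid. -/

/-! ### Chains of idempotents over local rings -/

theorem exists_completeOrthogonalIdempotents_of_chain {M : Type*} [Ring M] {r : ℕ} (P : Fin r → M)
    (h₁ : ∀ i j, j ≤ i → P i * P j = P j) (h₂ : ∀ i j, j ≤ i → P j * P i = P j) :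
    ∃ E : Fin (r + 1) → M, CompleteOrthogonalIdempotents E ∧
      (∀ i, P i = ∑ j, if j ≤ i.castSucc then E j else 0) ∧
      ∀ j, E j ∈ AddSubgroup.closure (insert 1 (Set.range P)) := by
  -- The chain is padded to `0, P_1, …, P_r, 1`, with indices shifted by one; the idempotents are
  -- its successive differences, so their sums telescope.
  let Q : ℕ → M := fun m => if m = 0 then 0 else if h : m - 1 < r then P ⟨m - 1, h⟩ else 1
  have hQ0 : Q 0 = 0 := by simp [Q]
  have hQ1 : Q (r + 1) = 1 := by simp [Q]
  have hQP (i : Fin r) : Q (i + 1) = P i := by simp [Q]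
  have hQ₁ : ∀ a b, b ≤ a → Q a * Q b = Q b := by
    intro a b hab
    simp only [Q]
    split_ifs <;> first | omega | simp | skip
    exact h₁ _ _ (by simp only [Fin.mk_le_mk]; omega)
  have hQ₂ : ∀ a b, b ≤ a → Q b * Q a = Q b := by
    intro a b hab
    simp only [Q]
    split_ifs <;> first | omega | simp | skip
    exact h₂ _ _ (by simp only [Fin.mk_le_mk]; omega)
  have hQmem (m : ℕ) : Q m ∈ AddSubgroup.closure (insert 1 (Set.range P)) := by
    simp only [Q]
    split_ifs
    · exact zero_mem _
    · exact AddSubgroup.subset_closure (Or.inr ⟨_, rfl⟩)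
    · exact AddSubgroup.subset_closure (Or.inl rfl)
  refine ⟨fun j => Q (j + 1) - Q j, ⟨⟨fun j => ?_, fun i j hij => ?_⟩, ?_⟩, fun i => ?_,
    fun j => sub_mem (hQmem _) (hQmem _)⟩
  · simp only [IsIdempotentElem, mul_sub, sub_mul]
    rw [hQ₁ _ _ le_rfl, hQ₁ _ _ le_rfl, hQ₁ _ _ (Nat.le_succ _), hQ₂ _ _ (Nat.le_succ _)]
    abel
  · simp only [mul_sub, sub_mul]
    rcases lt_or_gt_of_ne hij with h | h <;> have h : _ < _ := h
    · rw [hQ₂ _ _ (by omega), hQ₂ _ _ (by omega), hQ₂ _ _ (by omega), hQ₂ _ _ (by omega)]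
      abel
    · rw [hQ₁ _ _ (by omega), hQ₁ _ _ (by omega), hQ₁ _ _ (by omega), hQ₁ _ _ (by omega)]
      abel
  · rw [Fin.sum_univ_eq_sum_range (fun j => Q (j + 1) - Q j), Finset.sum_range_sub, hQ0, hQ1,
      sub_zero]
  · have : (∑ j : Fin (r + 1), if j ≤ i.castSucc then Q (j + 1) - Q j else 0) =
        ∑ j ∈ Finset.range (r + 1), if j ≤ (i : ℕ) then Q (j + 1) - Q j else 0 := by
      rw [← Fin.sum_univ_eq_sum_range (fun j => if j ≤ (i : ℕ) then Q (j + 1) - Q j else 0)]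
      simp [Fin.le_def]
    rw [this, ← Finset.sum_filter]
    have hf : (Finset.range (r + 1)).filter (· ≤ (i : ℕ)) = Finset.range (i + 1) := by
      ext j
      simp only [Finset.mem_filter, Finset.mem_range]
      omega
    rw [hf, Finset.sum_range_sub, hQ0, hQP, sub_zero]

/-- Over a local ring, a complete family of orthogonal idempotent matrices is simultaneously
diagonalizable. -/
theorem CompleteOrthogonalIdempotents.exists_mul_eq_mul_diagonal {R ι : Type*} [CommRing R]
    [IsLocalRing R] [Fintype ι] [DecidableEq ι] {n : ℕ} {E : ι → Matrix (Fin n) (Fin n) R}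
    (hE : CompleteOrthogonalIdempotents E) :
    ∃ (f : Fin n → ι) (g h : Matrix (Fin n) (Fin n) R), g * h = 1 ∧ h * g = 1 ∧
      ∀ j, E j * g = g * Matrix.diagonal fun c => if f c = j then 1 else 0 := by
  let W (j : ι) : Submodule R (Fin n → R) := LinearMap.range (E j).mulVecLin
  have hEW (j : ι) (w : W j) : (E j).mulVec w = w := by
    obtain ⟨_, v, rfl⟩ := w
    simp [Matrix.mulVec_mulVec, (hE.idem j).eq]
  have hEW' (i j : ι) (hij : i ≠ j) (w : W j) : (E i).mulVec w = 0 := by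
    obtain ⟨_, v, rfl⟩ := w
    simp [Matrix.mulVec_mulVec, hE.ortho hij]
  -- The image of an idempotent is a direct summand, hence projective, hence free over a local ring.
  have hfree (j : ι) : Module.Free R (W j) := by
    have : Module.Projective R (W j) :=
      .of_split (W j).subtype (E j).mulVecLin.rangeRestrict
        (LinearMap.ext fun w => Subtype.ext (by simpa using hEW j w))
    exact Module.free_of_flat_of_isLocalRing
  let e : (∀ j, W j) ≃ₗ[R] (Fin n → R) :=
    { toFun := fun w => ∑ j, (w j : Fin n → R)
      map_add' := fun w w' => by simp [Finset.sum_add_distrib]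
      map_smul' := fun a w => by simp [Finset.smul_sum]
      invFun := fun v j => (E j).mulVecLin.rangeRestrict v
      left_inv := fun w => by
        funext j
        apply Subtype.ext
        change (E j).mulVec (∑ i, (w i : Fin n → R)) = w j
        rw [Matrix.mulVec_sum, Finset.sum_eq_single j (fun i _ hij => hEW' j i hij.symm _) (by simp), hEW]
      right_inv := fun v => by
        simp [← Matrix.sum_mulVec, hE.complete] }
  let b₀ := (Pi.basis fun j => Module.Free.chooseBasis R (W j)).map e
  have hcard : Fintype.card (Σ j, Module.Free.ChooseBasisIndex R (W j)) = n := by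
    rw [← Module.finrank_eq_card_basis b₀, Module.finrank_fin_fun]
  let b := b₀.reindex (Fintype.equivFinOfCardEq hcard)
  let f (c : Fin n) : ι := ((Fintype.equivFinOfCardEq hcard).symm c).1
  have hb (c : Fin n) : ∃ w : W (f c), b c = w := by
    refine ⟨Module.Free.chooseBasis R (W (f c)) ((Fintype.equivFinOfCardEq hcard).symm c).2, ?_⟩
    simp only [b, b₀, Module.Basis.reindex_apply, Module.Basis.map_apply, Pi.basis_apply, e, f]
    simp only [LinearEquiv.coe_mk, LinearMap.coe_mk, AddHom.coe_mk]
    rw [Finset.sum_eq_single ((Fintype.equivFinOfCardEq hcard).symm c).1]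
    · simp
    · intro j _ hj
      simp [Pi.single_eq_of_ne hj]
    · simp
  refine ⟨f, (Pi.basisFun R (Fin n)).toMatrix b, b.toMatrix (Pi.basisFun R (Fin n)),
    Module.Basis.toMatrix_mul_toMatrix_flip _ _, Module.Basis.toMatrix_mul_toMatrix_flip _ _,
    fun j => ?_⟩
  have hcol (c : Fin n) : (E j).mulVec (b c) = if f c = j then b c else 0 := by
    obtain ⟨w, hw⟩ := hb c
    rw [hw]
    split_ifs with h
    · subst h
      exact hEW _ w
    · exact hEW' _ _ (Ne.symm h) w
  ext a c
  rw [Matrix.mul_diagonal]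
  have := congrFun (hcol c) a
  simp only [Matrix.mulVec, dotProduct] at this
  simp only [Matrix.mul_apply, Module.Basis.toMatrix_apply, Pi.basisFun_repr]
  rw [this]
  split_ifs <;> simp

/-- The diagonal matrix with `m` ones followed by zeros. -/
def truncId (R : Type*) [CommRing R] (n m : ℕ) : Matrix (Fin n) (Fin n) R :=
  Matrix.diagonal fun c => if (c : ℕ) < m then 1 else 0

theorem exists_mul_eq_mul_diagonal_of_chain {R : Type*} [CommRing R] [IsLocalRing R] {r n : ℕ}
    {P : Fin r → Matrix (Fin n) (Fin n) R}
    (h₁ : ∀ i j, j ≤ i → P i * P j = P j) (h₂ : ∀ i j, j ≤ i → P j * P i = P j) :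
    ∃ (f : Fin n → Fin (r + 1)) (g h : Matrix (Fin n) (Fin n) R), g * h = 1 ∧ h * g = 1 ∧
      (∀ i, P i * g = g * Matrix.diagonal fun c => if f c ≤ i.castSucc then 1 else 0) ∧
      ∀ i, (P i).trace = (Fintype.card {c // f c ≤ i.castSucc} : R) := by
  obtain ⟨E, hE, hPE, -⟩ := exists_completeOrthogonalIdempotents_of_chain P h₁ h₂
  obtain ⟨f, g, h, hgh, hhg, hf⟩ := hE.exists_mul_eq_mul_diagonal
  have hP (i : Fin r) :
      P i * g = g * Matrix.diagonal fun c => if f c ≤ i.castSucc then 1 else 0 := by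
    rw [hPE, Finset.sum_mul]
    ext a c
    simp only [ite_mul, zero_mul, hf, Matrix.sum_apply, apply_ite (fun M : Matrix _ _ R => M a c),
      Matrix.mul_diagonal, Matrix.zero_apply]
    rw [Finset.sum_eq_single (f c)]
    · simp
    · intro j _ hj
      simp [Ne.symm hj]
    · simp
  refine ⟨f, g, h, hgh, hhg, hP, fun i => ?_⟩
  have : P i = g * Matrix.diagonal (fun c => if f c ≤ i.castSucc then (1 : R) else 0) * h := by
    rw [← hP, mul_assoc, hgh, mul_one]
  rw [this, Matrix.trace_mul_comm, ← mul_assoc, hhg, one_mul, Matrix.trace_diagonal,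
    Finset.sum_boole, Fintype.card_subtype]

/-- Over a local ring of characteristic zero, a chain of idempotent matrices with traces `k i` is
conjugate to the standard one. -/
theorem exists_mul_eq_mul_truncId {R : Type*} [CommRing R] [IsLocalRing R] [CharZero R] {r n : ℕ}
    {k : Fin r → ℕ} {P : Fin r → Matrix (Fin n) (Fin n) R}
    (h₁ : ∀ i j, j ≤ i → P i * P j = P j) (h₂ : ∀ i j, j ≤ i → P j * P i = P j)
    (ht : ∀ i, (P i).trace = k i) :
    ∃ g h : Matrix (Fin n) (Fin n) R, g * h = 1 ∧ h * g = 1 ∧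
      ∀ i, P i * g = g * truncId R n (k i) := by
  obtain ⟨f, g, h, hgh, hhg, hP, htr⟩ := exists_mul_eq_mul_diagonal_of_chain h₁ h₂
  have hk (i : Fin r) : Fintype.card {c // f c ≤ i.castSucc} = k i := by
    have := (htr i).symm.trans (ht i)
    exact_mod_cast this
  -- Reordering the columns of `g` makes `f` monotone, so each set `f c ≤ i` becomes an initial
  -- segment, of length `k i`.
  let σ := Tuple.sort f
  have hσ (i : Fin r) (c : Fin n) : (f (σ c) ≤ i.castSucc) ↔ (c : ℕ) < k i := by
    have h1 := Tuple.lt_card_le_iff_apply_le_of_monotone (j := c) (a := i.castSucc)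
      (Tuple.monotone_sort f)
    rw [← hk i]
    refine h1.symm.trans ?_
    rw [← Fintype.card_subtype,
      Fintype.card_congr (Equiv.subtypeEquiv σ (p := fun c => (f ∘ σ) c ≤ i.castSucc)
        (q := fun c => f c ≤ i.castSucc) fun c => Iff.rfl)]
  refine ⟨g.submatrix id σ, h.submatrix σ id, ?_, ?_, fun i => ?_⟩
  · rw [Matrix.submatrix_mul_equiv, hgh, Matrix.submatrix_id_id]
  · rw [← Matrix.submatrix_mul _ _ _ _ _ Function.bijective_id, hhg, Matrix.submatrix_one_equiv]
  · ext a c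
    have := congrFun (congrFun (hP i) a) (σ c)
    simp only [Matrix.mul_diagonal, hσ] at this
    rw [truncId, Matrix.mul_diagonal]
    exact this

/-- If the trace of an idempotent matrix over a `ℚ`-algebra is a natural number up to a nilpotent,
then it is that number. -/
theorem trace_eq_natCast_of_isNilpotent {B : Type*} [CommRing B] [Algebra ℚ B] {n : ℕ}
    {P : Matrix (Fin n) (Fin n) B} (hP : P * P = P) {m : ℕ} (h : IsNilpotent (P.trace - m)) :
    P.trace = m := by
  rw [← sub_eq_zero]
  -- After localizing, diagonalization makes the trace a natural number `N`; as `ℚ` embeds in the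
  -- localization, a nilpotent `N - m` must vanish.
  refine eq_zero_of_localization _ fun J hJ => ?_
  let P' : Fin 1 → Matrix (Fin n) (Fin n) (Localization.AtPrime J) :=
    fun _ => P.map (algebraMap B _)
  have hP' : ∀ i j, j ≤ i → P' i * P' j = P' j := fun i j _ => by
    simp only [P', ← Matrix.map_mul, hP]
  obtain ⟨f, -, -, -, -, -, htr⟩ := exists_mul_eq_mul_diagonal_of_chain hP'
    (fun i j _ => hP' j i (by simp [Subsingleton.elim i j]))
  have ht := htr 0
  set N := Fintype.card {c // f c ≤ (0 : Fin 1).castSucc}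
  have ht' : algebraMap B (Localization.AtPrime J) P.trace = N := by
    rw [← ht]
    exact (AddMonoidHom.map_trace (algebraMap B (Localization.AtPrime J)).toAddMonoidHom P)
  have hnil := h.map (algebraMap B (Localization.AtPrime J))
  rw [map_sub, ht', map_natCast] at hnil ⊢
  have : CharZero (Localization.AtPrime J) := algebraRat.charZero _
  have hq : ((N : ℚ) - m) = 0 := by
    rw [← isNilpotent_iff_eq_zero,
      ← IsNilpotent.map_iff (algebraMap ℚ (Localization.AtPrime J)).injective]
    simpa using hnil
  have : N = m := by exact_mod_cast sub_eq_zero.1 hq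
  rw [this, sub_self]

/-! ### Projection flags over arbitrary rings -/

/-- Flags of symmetric idempotent matrices with prescribed traces over a commutative ring. -/
structure IsProjFlag {R : Type*} [CommRing R] {r n : ℕ} (k : Fin r → ℕ)
    (P : Fin r → Matrix (Fin n) (Fin n) R) : Prop where
  isSymm : ∀ i, (P i).IsSymm
  mul_eq : ∀ i j, j ≤ i → P i * P j = P j
  trace_eq : ∀ i, (P i).trace = k i

namespace IsProjFlag

variable {R : Type*} [CommRing R] {r n : ℕ} {k : Fin r → ℕ}
  {P : Fin r → Matrix (Fin n) (Fin n) R}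

theorem mul_eq' (hP : IsProjFlag k P) (i j : Fin r) (h : j ≤ i) : P j * P i = P j := by
  have := congrArg Matrix.transpose (hP.mul_eq i j h)
  rwa [Matrix.transpose_mul, (hP.isSymm i).eq, (hP.isSymm j).eq] at this

/-- The idempotency and consecutive inclusions suffice for a projection flag. -/
theorem of_consecutive (hs : ∀ i, (P i).IsSymm)
    (hc : ∀ i j : Fin r, (j : ℕ) + 1 = i → P i * P j = P j) (hi : ∀ i, P i * P i = P i)
    (ht : ∀ i, (P i).trace = k i) : IsProjFlag k P := by
  refine ⟨hs, ?_, ht⟩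
  rintro ⟨i, hir⟩ ⟨j, hjr⟩ hij
  have hij : j ≤ i := hij
  induction i, hij using Nat.le_induction with
  | base => exact hi _
  | succ i hij ih =>
    have hi' : i < r := by omega
    rw [← ih hi' (Fin.mk_le_mk.2 ‹_›), ← mul_assoc, hc ⟨i + 1, hir⟩ ⟨i, hi'⟩ rfl]

end IsProjFlag

theorem mem_pFl_iff_isProjFlag {r n : ℕ} {k : Fin r → ℕ} {P : Fin r → Matrix (Fin n) (Fin n) ℂ} :
    P ∈ pFl k n ↔ IsProjFlag k P :=
  ⟨fun h => ⟨h.1, h.2.1, h.2.2⟩, fun h => ⟨h.1, h.2, h.3⟩⟩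

/-! ### Points of the flag equations -/

section Coordinates

variable {r n : ℕ}

theorem isSymm_symTuple {R : Type*} (x : SymVar r n → R) (i : Fin r) : (symTuple x i).IsSymm :=
  symTuple_bijOn.mapsTo (Set.mem_univ x) i

theorem exists_symTuple_eq {R : Type*} {P : Fin r → Matrix (Fin n) (Fin n) R} (hP : ∀ i, (P i).IsSymm) :
    ∃ x, symTuple x = P := by
  obtain ⟨x, -, hx⟩ := symTuple_bijOn.surjOn (show P ∈ {P | ∀ i, (P i).IsSymm} from hP)
  exact ⟨x, hx⟩

variable {R : Type*} [CommRing R] [Algebra ℂ R]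

theorem map_genericSym (φ : SymRing r n →ₐ[ℂ] R) (i : Fin r) :
    (genericSym r n i).map φ = symTuple (fun v => φ (MvPolynomial.X v)) i :=
  rfl

/-- The projection flags over `R` are the `R`-points of the flag equations. -/
theorem flagEquationsIdeal_le_ker_iff {k : Fin r → ℕ} (φ : SymRing r n →ₐ[ℂ] R) :
    flagEquationsIdeal k n ≤ RingHom.ker φ ↔
      IsProjFlag k (symTuple fun v => φ (MvPolynomial.X v)) := by
  have hmul (i j : Fin r) (a b : Fin n) :
      φ ((genericSym r n i * genericSym r n j) a b) =
        (symTuple (fun v => φ (MvPolynomial.X v)) i *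
          symTuple (fun v => φ (MvPolynomial.X v)) j) a b := by
    rw [← map_genericSym, ← map_genericSym, ← Matrix.map_mul, Matrix.map_apply]
  have hone (i : Fin r) (a b : Fin n) : φ (genericSym r n i a b) =
      symTuple (fun v => φ (MvPolynomial.X v)) i a b := rfl
  have htr (i : Fin r) : φ (genericSym r n i).trace =
      (symTuple (fun v => φ (MvPolynomial.X v)) i).trace := by
    simp [Matrix.trace, hone]
  rw [flagEquationsIdeal, sup_le_iff, Ideal.span_le, Ideal.span_le, Set.union_subset_iff]
  constructor
  · rintro ⟨hc, hi, ht⟩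
    refine .of_consecutive (fun i => isSymm_symTuple _ i) (fun i j hij => ?_) (fun i => ?_)
      fun i => ?_
    · ext a b
      have : φ ((genericSym r n i * genericSym r n j - genericSym r n j) a b) = 0 :=
        hc ⟨i, j, hij, a, b, rfl⟩
      rwa [Matrix.sub_apply, map_sub, hmul, hone, sub_eq_zero] at this
    · ext a b
      have : φ ((genericSym r n i ^ 2 - genericSym r n i) a b) = 0 := hi ⟨i, a, b, rfl⟩
      rwa [pow_two, Matrix.sub_apply, map_sub, hmul, hone, sub_eq_zero] at this
    · have : φ ((genericSym r n i).trace - MvPolynomial.C (k i : ℂ)) = 0 := ht ⟨i, rfl⟩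
      rw [map_sub, htr, sub_eq_zero] at this
      simpa using this
  · intro h
    refine ⟨?_, ?_, ?_⟩
    · rintro _ ⟨i, j, hij, a, b, rfl⟩
      rw [SetLike.mem_coe, RingHom.mem_ker, Matrix.sub_apply, map_sub, hmul, hone,
        h.mul_eq i j (by rw [Fin.le_def]; omega), sub_self]
    · rintro _ ⟨i, a, b, rfl⟩
      rw [SetLike.mem_coe, RingHom.mem_ker, pow_two, Matrix.sub_apply, map_sub, hmul, hone,
        h.mul_eq i i le_rfl, sub_self]
    · rintro _ ⟨i, rfl⟩
      rw [SetLike.mem_coe, RingHom.mem_ker, map_sub, htr, h.trace_eq]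
      simp

theorem isProjFlag_of_algHom_quotient {k : Fin r → ℕ}
    (φ : SymRing r n ⧸ flagEquationsIdeal k n →ₐ[ℂ] R) :
    IsProjFlag k (symTuple fun v => φ (Ideal.Quotient.mkₐ ℂ _ (MvPolynomial.X v))) := by
  refine (flagEquationsIdeal_le_ker_iff (φ.comp (Ideal.Quotient.mkₐ ℂ _))).1 fun f hf => ?_
  rw [RingHom.mem_ker, AlgHom.comp_apply, Ideal.Quotient.mkₐ_eq_mk,
    Ideal.Quotient.eq_zero_iff_mem.2 hf, map_zero]

end Coordinates

/-! ### Orthogonal projections from Gram matrices -/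

section Parametrization

variable {R S : Type*} [CommRing R] [CommRing S] {n : ℕ}

theorem truncId_mul_truncId {m m' : ℕ} (h : m ≤ m') :
    truncId R n m' * truncId R n m = truncId R n m := by
  rw [truncId, truncId, Matrix.diagonal_mul_diagonal]
  congr 1
  funext c
  split_ifs <;> first | omega | simp

theorem transpose_truncId (m : ℕ) : (truncId R n m).transpose = truncId R n m :=
  Matrix.diagonal_transpose _

theorem trace_truncId {m : ℕ} (h : m ≤ n) : (truncId R n m).trace = m := by
  rw [truncId, Matrix.trace_diagonal, Finset.sum_boole]
  congr 1
  simpa [min_eq_right h] using Fin.card_filter_val_lt (n := n) (m := m)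

theorem map_truncId (f : R →+* S) (m : ℕ) : (truncId R n m).map f = truncId S n m := by
  rw [truncId, truncId, Matrix.diagonal_map (map_zero f)]
  congr 1
  funext c
  split_ifs <;> simp

/-- The Gram matrix of the first `m` columns of `g`, extended by an identity block. -/
def truncGram (g : Matrix (Fin n) (Fin n) R) (m : ℕ) : Matrix (Fin n) (Fin n) R :=
  truncId R n m * (g.transpose * g) * truncId R n m + (1 - truncId R n m)

/-- The orthogonal projection onto the span of the first `m` columns of `g`. -/
noncomputable def gramProj (g : Matrix (Fin n) (Fin n) R) (m : ℕ) : Matrix (Fin n) (Fin n) R :=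
  g * truncId R n m * (truncGram g m)⁻¹ * truncId R n m * g.transpose

theorem map_truncGram (f : R →+* S) (g : Matrix (Fin n) (Fin n) R) (m : ℕ) :
    (truncGram g m).map f = truncGram (g.map f) m := by
  simp only [truncGram, Matrix.map_add f (map_add f), Matrix.map_sub f (map_sub f), Matrix.map_mul,
    map_truncId, Matrix.map_one f (map_zero f) (map_one f), Matrix.transpose_map]

theorem map_gramProj (f : R →+* S) {g : Matrix (Fin n) (Fin n) R} {m : ℕ}
    (h : IsUnit (truncGram g m).det) : (gramProj g m).map f = gramProj (g.map f) m := by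
  have : (truncGram g m)⁻¹.map f = (truncGram (g.map f) m)⁻¹ := by
    refine (Matrix.inv_eq_right_inv ?_).symm
    rw [← map_truncGram, ← Matrix.map_mul, Matrix.mul_nonsing_inv _ h,
      Matrix.map_one f (map_zero f) (map_one f)]
  simp only [gramProj, Matrix.map_mul, map_truncId, this, Matrix.transpose_map]

/-- Multiplying by `truncId` kills the identity block, which serves only to make the truncated Gram
matrix invertible at full size. -/
theorem truncId_mul_gram_mul_truncId (g : Matrix (Fin n) (Fin n) R) (m : ℕ) :
    truncId R n m * (g.transpose * g) * truncId R n m = truncId R n m * truncGram g m ∧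
    truncId R n m * (g.transpose * g) * truncId R n m = truncGram g m * truncId R n m := by
  have hD := truncId_mul_truncId (R := R) (n := n) (le_refl m)
  constructor
  · rw [truncGram, mul_add, mul_sub, mul_one, hD, sub_self, add_zero]
    simp only [← mul_assoc, hD]
  · rw [truncGram, add_mul, sub_mul, one_mul, hD, sub_self, add_zero,
      mul_assoc _ (truncId R n m) (truncId R n m), hD]

theorem gramProj_mul_mul_truncId {g : Matrix (Fin n) (Fin n) R} {m : ℕ}
    (h : IsUnit (truncGram g m).det) : gramProj g m * (g * truncId R n m) = g * truncId R n m := by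
  calc gramProj g m * (g * truncId R n m)
      = g * truncId R n m * (truncGram g m)⁻¹ *
          (truncId R n m * (g.transpose * g) * truncId R n m) := by
        simp only [gramProj, mul_assoc]
    _ = g * truncId R n m := by
        rw [(truncId_mul_gram_mul_truncId g m).2, mul_assoc _ _ (truncGram g m * _),
          Matrix.nonsing_inv_mul_cancel_left _ _ h, mul_assoc, truncId_mul_truncId le_rfl]

theorem isProjFlag_gramProj {r : ℕ} {k : Fin r → ℕ} (hk : Monotone k) (hn : ∀ i, k i ≤ n)
    {g : Matrix (Fin n) (Fin n) R} (h : ∀ i, IsUnit (truncGram g (k i)).det) :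
    IsProjFlag k fun i => gramProj g (k i) where
  isSymm i := by
    have : (truncGram g (k i)).transpose = truncGram g (k i) := by
      simp only [truncGram, Matrix.transpose_add, Matrix.transpose_sub, Matrix.transpose_mul,
        transpose_truncId, Matrix.transpose_one, Matrix.transpose_transpose, mul_assoc]
    simp only [Matrix.IsSymm, gramProj, Matrix.transpose_mul, Matrix.transpose_nonsing_inv, this,
      transpose_truncId, Matrix.transpose_transpose, mul_assoc]
  mul_eq i j hij := by
    have : gramProj g (k i) * (g * truncId R n (k j)) = g * truncId R n (k j) := by
      rw [← truncId_mul_truncId (R := R) (hk hij), ← mul_assoc g, ← mul_assoc,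
        gramProj_mul_mul_truncId (h i)]
    conv_lhs => rw [gramProj.eq_def g (k j)]
    simp only [← mul_assoc] at this ⊢
    rw [this, gramProj]
  trace_eq i := by
    rw [gramProj, mul_assoc _ _ g.transpose, mul_assoc, Matrix.trace_mul_comm]
    have : (truncGram g (k i))⁻¹ * (truncId R n (k i) * g.transpose) * (g * truncId R n (k i)) =
        truncId R n (k i) := by
      calc _ = (truncGram g (k i))⁻¹ *
            (truncId R n (k i) * (g.transpose * g) * truncId R n (k i)) := by
            simp only [mul_assoc]
        _ = _ := by
          rw [(truncId_mul_gram_mul_truncId g (k i)).2, Matrix.nonsing_inv_mul_cancel_left _ _ (h i)]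
    rw [this, trace_truncId (hn i)]

/-- A symmetric idempotent which `g` conjugates to a standard one is the orthogonal projection onto
the span of the first columns of `g`. -/
theorem gramProj_eq_of_mul_eq {P g h : Matrix (Fin n) (Fin n) R} {m : ℕ} (hP : P.IsSymm)
    (hPP : P * P = P) (hgh : g * h = 1) (hhg : h * g = 1) (hPg : P * g = g * truncId R n m) :
    IsUnit (truncGram g m).det ∧ gramProj g m = P := by
  set D := truncId R n m with hD
  have hDD : D * D = D := truncId_mul_truncId le_rfl
  have hDt : D.transpose = D := transpose_truncId m
  have hP' : P = g * D * h := by rw [← hPg, mul_assoc, hgh, mul_one]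
  have hPt : P = h.transpose * D * g.transpose := by
    rw [← hP.eq, hP', Matrix.transpose_mul, Matrix.transpose_mul, hDt, mul_assoc]
  have hgth : g.transpose * h.transpose = 1 := by
    rw [← Matrix.transpose_mul, hhg, Matrix.transpose_one]
  -- The inverse of the Gram block is the corresponding block of `h * hᵀ`, because `P` is both `g *
  -- D * h` and its transpose.
  have key : D * (g.transpose * g) * D * (D * (h * h.transpose) * D) = D := by
    calc _ = D * g.transpose * (g * (D * D) * h) * h.transpose * D := by simp only [mul_assoc]
      _ = D * (g.transpose * h.transpose) * D * (g.transpose * h.transpose) * D := by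
        rw [hDD, ← hP', hPt]; simp only [mul_assoc]
      _ = D := by rw [hgth]; simp only [mul_one, hDD]
  have hinv : truncGram g m * (D * (h * h.transpose) * D + (1 - D)) = 1 := by
    have h1 : D * (1 - D) = 0 := by rw [mul_sub, mul_one, hDD, sub_self]
    have h2 : (1 - D) * D = 0 := by rw [sub_mul, one_mul, hDD, sub_self]
    have h3 : (1 - D) * (1 - D) = 1 - D := by rw [mul_sub, mul_one, h2, sub_zero]
    rw [truncGram, ← hD, add_mul, mul_add, mul_add, key, h3, mul_assoc _ D (1 - D), h1,
      mul_zero, ← mul_assoc (1 - D), ← mul_assoc (1 - D), h2, zero_mul, zero_mul]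
    abel
  refine ⟨Matrix.isUnit_det_of_right_inverse hinv, ?_⟩
  have h1 : D * (1 - D) = 0 := by rw [mul_sub, mul_one, hDD, sub_self]
  calc gramProj g m = g * (D * (D * (h * h.transpose) * D + (1 - D)) * D) * g.transpose := by
        rw [gramProj, Matrix.inv_eq_right_inv hinv]; simp only [mul_assoc, hD]
    _ = g * (D * D) * h * (h.transpose * (D * D) * g.transpose) := by
        rw [mul_add, h1]; simp only [add_zero, mul_assoc]
    _ = P := by rw [hDD, ← hPt, ← hP', hPP]

end Parametrization

/-! ### Primality and the vanishing ideal -/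

section Primality

/-- The matrix of independent indeterminates. -/
noncomputable def genericMat (n : ℕ) : Matrix (Fin n) (Fin n) (MvPolynomial (Fin n × Fin n) ℂ) :=
  Matrix.of fun a b => MvPolynomial.X (a, b)

/-- The product of the Gram determinants of a generic matrix. -/
noncomputable def genericGramDet {r : ℕ} (k : Fin r → ℕ) (n : ℕ) :
    MvPolynomial (Fin n × Fin n) ℂ :=
  ∏ i, (truncGram (genericMat n) (k i)).det

variable {r : ℕ} (k : Fin r → ℕ) (n : ℕ)

theorem map_aeval_genericMat {R : Type*} [CommRing R] [Algebra ℂ R]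
    (g : Matrix (Fin n) (Fin n) R) :
    (genericMat n).map (MvPolynomial.aeval fun p => g p.1 p.2 :
      MvPolynomial (Fin n × Fin n) ℂ →ₐ[ℂ] R) = g := by
  ext a b
  simp [genericMat]

theorem aeval_genericGramDet {R : Type*} [CommRing R] [Algebra ℂ R]
    (g : Matrix (Fin n) (Fin n) R) :
    MvPolynomial.aeval (fun p => g p.1 p.2) (genericGramDet k n) =
      ∏ i, (truncGram g (k i)).det := by
  rw [genericGramDet, map_prod]
  refine Finset.prod_congr rfl fun i _ => ?_
  have := RingHom.map_det (MvPolynomial.aeval fun p => g p.1 p.2 :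
    MvPolynomial (Fin n × Fin n) ℂ →ₐ[ℂ] R).toRingHom (truncGram (genericMat n) (k i))
  rw [RingHom.mapMatrix_apply, map_truncGram] at this
  refine this.trans ?_
  congr 2
  exact map_aeval_genericMat n g

/-- At `g = 1` every truncated Gram matrix is the identity. This makes the localization `L` a
domain. -/
theorem genericGramDet_ne_zero : genericGramDet k n ≠ 0 := by
  intro h
  have := aeval_genericGramDet k n (1 : Matrix (Fin n) (Fin n) ℂ)
  rw [h, map_zero] at this
  have hone (m : ℕ) : truncGram (1 : Matrix (Fin n) (Fin n) ℂ) m = 1 := by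
    rw [truncGram, Matrix.transpose_one, mul_one, mul_one, truncId_mul_truncId le_rfl]
    abel
  simp [hone] at this

variable {k n}

theorem flagEquationsIdeal_isPrime (hk : Monotone k) (hn : ∀ i, k i ≤ n) :
    (flagEquationsIdeal k n).IsPrime := by
  let U := MvPolynomial (Fin n × Fin n) ℂ
  let L := Localization.Away (genericGramDet k n)
  have : IsDomain L := IsLocalization.isDomain_localization
    (powers_le_nonZeroDivisors_of_noZeroDivisors (genericGramDet_ne_zero k n))
  let G : Matrix (Fin n) (Fin n) L := (genericMat n).map (algebraMap U L)
  have hG (i : Fin r) : IsUnit (truncGram G (k i)).det := by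
    have h : IsUnit (algebraMap U L (∏ i, (truncGram (genericMat n) (k i)).det)) :=
      IsLocalization.Away.algebraMap_isUnit (genericGramDet k n)
    rw [map_prod, IsUnit.prod_univ_iff] at h
    have := h i
    rwa [RingHom.map_det, RingHom.mapMatrix_apply, map_truncGram] at this
  have hflag := isProjFlag_gramProj hk hn hG
  obtain ⟨x, hx⟩ := exists_symTuple_eq hflag.isSymm
  let φ : SymRing r n →ₐ[ℂ] L := MvPolynomial.aeval x
  have hφx : (fun v => φ (MvPolynomial.X v)) = x := by
    funext v
    simp [φ]
  suffices h : flagEquationsIdeal k n = RingHom.ker φ by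
    rw [h]
    exact RingHom.ker_isPrime φ
  refine le_antisymm ?_ fun f hf => ?_
  · rw [flagEquationsIdeal_le_ker_iff, hφx, hx]
    exact hflag
  rw [← Ideal.Quotient.eq_zero_iff_mem]
  -- Only local vanishing is needed, and over the local ring `B` the tautological flag comes from an
  -- actual matrix `g`.
  refine eq_zero_of_localization _ fun J hJ => ?_
  let A := SymRing r n ⧸ flagEquationsIdeal k n
  let B := Localization.AtPrime J
  let ψ : SymRing r n →ₐ[ℂ] B :=
    (IsScalarTower.toAlgHom ℂ A B).comp (Ideal.Quotient.mkₐ ℂ (flagEquationsIdeal k n))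
  change ψ f = 0
  have hψ : IsProjFlag k (symTuple fun v => ψ (MvPolynomial.X v)) :=
    isProjFlag_of_algHom_quotient (R := B) (IsScalarTower.toAlgHom ℂ A B)
  have : CharZero B := algebraRat.charZero _
  obtain ⟨g, h, hgh, hhg, hg⟩ := exists_mul_eq_mul_truncId hψ.mul_eq hψ.mul_eq' hψ.trace_eq
  have hgP (i : Fin r) := gramProj_eq_of_mul_eq (hψ.isSymm i) (hψ.mul_eq i i le_rfl) hgh hhg (hg i)
  let θ : U →ₐ[ℂ] B := MvPolynomial.aeval fun p => g p.1 p.2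
  have hθ : IsUnit (θ (genericGramDet k n)) := by
    have h1 : θ (genericGramDet k n) = _ := aeval_genericGramDet k n g
    rw [h1, IsUnit.prod_univ_iff]
    exact fun i => (hgP i).1
  -- Specializing the generic matrix to `g` is possible since its Gram determinants are units; then
  -- `μ ∘ φ = ψ`, so `φ f = 0` gives `ψ f = 0`.
  let μ : L →+* B := IsLocalization.Away.lift (genericGramDet k n) (g := θ.toRingHom) hθ
  have hμ : G.map μ = g := by
    conv_rhs => rw [← map_aeval_genericMat n g]
    ext a b
    exact IsLocalization.Away.lift_eq _ hθ _
  have hμφ : μ.comp φ.toRingHom = ψ.toRingHom := by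
    refine MvPolynomial.ringHom_ext (fun c => ?_) fun ⟨i, e⟩ => ?_
    · have h1 : φ (MvPolynomial.C c) = algebraMap U L (algebraMap ℂ U c) := by
        rw [← IsScalarTower.algebraMap_apply]
        exact φ.commutes c
      change μ (φ (MvPolynomial.C c)) = ψ (MvPolynomial.C c)
      rw [h1]
      refine (IsLocalization.Away.lift_eq _ hθ _).trans ?_
      exact (θ.commutes c).trans (ψ.commutes c).symm
    · induction e with
      | _ a b =>
        have h1 : φ (MvPolynomial.X (i, s(a, b))) = gramProj G (k i) a b := by
          rw [← congrFun hx i, ← hφx]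
          rfl
        change μ (φ (MvPolynomial.X (i, s(a, b)))) = ψ (MvPolynomial.X (i, s(a, b)))
        rw [h1]
        have h2 := congrFun (congrFun (map_gramProj (S := B) μ (hG i)) a) b
        rw [hμ, (hgP i).2] at h2
        exact h2
  have := RingHom.congr_fun hμφ f
  refine this.symm.trans ?_
  change μ (φ f) = 0
  rw [show φ f = 0 from hf, map_zero]

theorem zeroLocus_flagEquationsIdeal :
    MvPolynomial.zeroLocus ℂ (flagEquationsIdeal k n) = pFlPoints k n := by
  ext x
  have h := flagEquationsIdeal_le_ker_iff (k := k) (MvPolynomial.aeval x : SymRing r n →ₐ[ℂ] ℂ)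
  simp only [MvPolynomial.aeval_X] at h
  exact h.trans mem_pFl_iff_isProjFlag.symm

theorem pFlIdeal_eq_flagEquationsIdeal (hk : Monotone k) (hn : ∀ i, k i ≤ n) :
    pFlIdeal k n = flagEquationsIdeal k n := by
  rw [pFlIdeal, ← zeroLocus_flagEquationsIdeal, MvPolynomial.vanishingIdeal_zeroLocus_eq_radical]
  exact (flagEquationsIdeal_isPrime hk hn).isRadical.radical

end Primality

/-! ### Infinitesimal lifting and smoothness -/

theorem CompleteOrthogonalIdempotents.aeval_sum_smul {K M ι : Type*} [Field K] [Ring M]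
    [Algebra K M] [Fintype ι] [DecidableEq ι] {E : ι → M} (hE : CompleteOrthogonalIdempotents E)
    (c : ι → K) (p : Polynomial K) :
    Polynomial.aeval (∑ j, c j • E j) p = ∑ j, p.eval (c j) • E j := by
  induction p using Polynomial.induction_on with
  | C a => simp [← Finset.smul_sum, hE.complete, Algebra.algebraMap_eq_smul_one]
  | add p q hp hq => simp [hp, hq, add_smul, Finset.sum_add_distrib]
  | monomial m a h =>
    rw [pow_succ, ← mul_assoc, map_mul, h, Polynomial.aeval_X, Finset.sum_mul_sum]
    refine Finset.sum_congr rfl fun j _ => ?_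
    simp only [smul_mul_smul_comm, hE.mul_eq, smul_ite, smul_zero, Finset.sum_ite_eq,
      Finset.mem_univ, if_true]
    congr 1
    simp [mul_assoc]

theorem CompleteOrthogonalIdempotents.sum_mul_sum_eq {M ι : Type*} [Ring M]
    [Fintype ι] [DecidableEq ι] {E : ι → M} (hE : CompleteOrthogonalIdempotents E)
    {p q : ι → Prop} [DecidablePred p] [DecidablePred q] (h : ∀ j, q j → p j) :
    (∑ j, if p j then E j else 0) * (∑ j, if q j then E j else 0) =
      ∑ j, if q j then E j else 0 := by
  rw [Finset.sum_mul_sum, Finset.sum_comm]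
  refine Finset.sum_congr rfl fun j _ => ?_
  rw [Finset.sum_eq_single j]
  · split_ifs with hp hq
    · exact (hE.idem j).eq
    · exact mul_zero _
    · exact absurd (h j ‹_›) hp
    · exact mul_zero _
  · intro i _ hij
    split_ifs <;> simp [hE.ortho hij]
  · simp

theorem Matrix.IsSymm.aeval {K R m : Type*} [CommRing K] [CommRing R] [Algebra K R] [Fintype m]
    [DecidableEq m] {T : Matrix m m R} (hT : T.IsSymm) (p : Polynomial K) :
    (Polynomial.aeval T p).IsSymm := by
  simp only [Matrix.IsSymm, Polynomial.aeval_eq_sum_range, Matrix.transpose_sum,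
    Matrix.transpose_smul, Matrix.transpose_pow, hT.eq]

theorem Matrix.IsSymm.exists_lift {B m : Type*} [CommRing B] {I : Ideal B}
    {T : Matrix m m (B ⧸ I)} (hT : T.IsSymm) :
    ∃ T' : Matrix m m B, T'.IsSymm ∧ T'.map (Ideal.Quotient.mk I) = T := by
  let s := Function.surjInv (Ideal.Quotient.mk_surjective (I := I))
  refine ⟨T.map s, hT.map s, ?_⟩
  ext a b
  exact Function.surjInv_eq _ _

theorem Matrix.mul_self_eq_zero_of_map_mk_eq_zero {B m : Type*} [CommRing B] [Fintype m]
    {I : Ideal B} (hI : I ^ 2 = ⊥) {X : Matrix m m B} (hX : X.map (Ideal.Quotient.mk I) = 0) :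
    X * X = 0 := by
  have hmem (a b : m) : X a b ∈ I := Ideal.Quotient.eq_zero_iff_mem.1 (congrFun (congrFun hX a) b)
  ext a b
  refine Finset.sum_eq_zero fun c _ => ?_
  rw [← Ideal.mem_bot, ← hI, pow_two]
  exact Ideal.mul_mem_mul (hmem _ _) (hmem _ _)

/-- Complete families of symmetric orthogonal idempotents lift along square-zero extensions: they
are polynomials in a single symmetric matrix. -/
theorem CompleteOrthogonalIdempotents.exists_symm_lift {B : Type*} [CommRing B] [Algebra ℂ B]
    {I : Ideal B} (hI : I ^ 2 = ⊥) {n r : ℕ} {E : Fin r → Matrix (Fin n) (Fin n) (B ⧸ I)}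
    (hE : CompleteOrthogonalIdempotents E) (hs : ∀ j, (E j).IsSymm) :
    ∃ E' : Fin r → Matrix (Fin n) (Fin n) B, CompleteOrthogonalIdempotents E' ∧
      (∀ j, (E' j).IsSymm) ∧ ∀ j, (E' j).map (Ideal.Quotient.mk I) = E j := by
  -- The coefficients are distinct complex numbers, so Lagrange interpolation recovers each `E j` as
  -- a polynomial in `T`.
  let T := ∑ j : Fin r, ((j : ℕ) : ℂ) • E j
  have hT : T.IsSymm := by
    simp only [T, Matrix.IsSymm, Matrix.transpose_sum, Matrix.transpose_smul, (hs _).eq]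
  obtain ⟨T', hT', hTT'⟩ := hT.exists_lift
  let π : Matrix (Fin n) (Fin n) B →ₐ[ℂ] Matrix (Fin n) (Fin n) (B ⧸ I) :=
    (Ideal.Quotient.mkₐ ℂ I).mapMatrix
  have hπT : π T' = T := hTT'
  -- Lifting inside `ℂ[T']` keeps the idempotents symmetric, since polynomials in a symmetric matrix
  -- are symmetric.
  let S := (Polynomial.aeval (R := ℂ) T').range
  let f : S →+* Matrix (Fin n) (Fin n) (B ⧸ I) := (π.comp S.val).toRingHom
  have hker : ∀ x ∈ RingHom.ker f, IsNilpotent x := fun x hx => by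
    refine ⟨2, Subtype.ext ?_⟩
    rw [pow_two]
    exact Matrix.mul_self_eq_zero_of_map_mk_eq_zero hI hx
  have hrange : ∀ j, E j ∈ f.range := fun j => by
    let p := Lagrange.basis Finset.univ (fun j : Fin r => ((j : ℕ) : ℂ)) j
    have hinj : Set.InjOn (fun j : Fin r => ((j : ℕ) : ℂ)) (Finset.univ : Finset (Fin r)) :=
      fun a _ b _ hab => Fin.ext (Nat.cast_injective hab)
    refine ⟨⟨Polynomial.aeval T' p, p, rfl⟩, ?_⟩
    change π (Polynomial.aeval T' p) = E j
    rw [← Polynomial.aeval_algHom_apply, hπT, hE.aeval_sum_smul, Finset.sum_eq_single j]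
    · rw [Lagrange.eval_basis_self hinj (Finset.mem_univ j), one_smul]
    · intro i _ hij
      have := Lagrange.eval_basis_of_ne (v := fun j : Fin r => ((j : ℕ) : ℂ)) hij.symm (Finset.mem_univ i)
      simp only [p, this, zero_smul]
    · simp
  obtain ⟨e, he, hfe⟩ := CompleteOrthogonalIdempotents.lift_of_isNilpotent_ker f hker hE hrange
  refine ⟨fun j => e j, he.map S.val.toRingHom, fun j => ?_, fun j => congrFun hfe j⟩
  obtain ⟨p, hp⟩ := (e j).2
  change (e j : Matrix (Fin n) (Fin n) B).IsSymm
  rw [← hp]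
  exact hT'.aeval p

theorem IsProjFlag.exists_lift {B : Type*} [CommRing B] [Algebra ℂ B] {I : Ideal B}
    (hI : I ^ 2 = ⊥) {r n : ℕ} {k : Fin r → ℕ} {P : Fin r → Matrix (Fin n) (Fin n) (B ⧸ I)}
    (hP : IsProjFlag k P) :
    ∃ P' : Fin r → Matrix (Fin n) (Fin n) B, IsProjFlag k P' ∧
      ∀ i, (P' i).map (Ideal.Quotient.mk I) = P i := by
  obtain ⟨E, hE, hPE, hmem⟩ := exists_completeOrthogonalIdempotents_of_chain P hP.mul_eq hP.mul_eq'
  have hs (j : Fin (r + 1)) : (E j).IsSymm := by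
    refine AddSubgroup.closure_induction ?_ ?_ (fun _ _ _ _ => .add) (fun _ _ => .neg) (hmem j)
    · rintro _ (rfl | ⟨i, rfl⟩)
      · exact Matrix.isSymm_one
      · exact hP.isSymm i
    · exact Matrix.isSymm_zero
  obtain ⟨E', hE', hs', hEE'⟩ := hE.exists_symm_lift hI hs
  let P' : Fin r → Matrix (Fin n) (Fin n) B := fun i => ∑ j, if j ≤ i.castSucc then E' j else 0
  have hmap (i : Fin r) : (P' i).map (Ideal.Quotient.mk I) = P i := by
    change (Ideal.Quotient.mk I).mapMatrix (P' i) = P i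
    rw [hPE, map_sum]
    refine Finset.sum_congr rfl fun j _ => ?_
    split_ifs
    · exact hEE' j
    · exact map_zero _
  have hmul (i j : Fin r) (hij : j ≤ i) : P' i * P' j = P' j :=
    hE'.sum_mul_sum_eq fun l hl => hl.trans hij
  refine ⟨P', ⟨fun i => ?_, hmul, fun i => ?_⟩, hmap⟩
  · simp only [P', Matrix.IsSymm, Matrix.transpose_sum]
    refine Finset.sum_congr rfl fun j _ => ?_
    split_ifs
    · exact hs' j
    · exact Matrix.transpose_zero
  · let := Algebra.compHom B (algebraMap ℚ ℂ)
    -- The trace is correct modulo `I`, so its error squares to zero; for an idempotent this forces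
    -- equality.
    refine trace_eq_natCast_of_isNilpotent (hmul i i le_rfl) ⟨2, ?_⟩
    have : (P' i).trace - k i ∈ I := by
      rw [← Ideal.Quotient.eq_zero_iff_mem, map_sub, map_natCast, ← hP.trace_eq i, ← hmap i,
        sub_eq_zero]
      exact AddMonoidHom.map_trace (Ideal.Quotient.mk I).toAddMonoidHom _
    rw [← Ideal.mem_bot, ← hI]
    exact Ideal.pow_mem_pow this 2

theorem smooth_quotient_flagEquationsIdeal {r n : ℕ} (k : Fin r → ℕ) :
    Algebra.Smooth ℂ (SymRing r n ⧸ flagEquationsIdeal k n) where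
  finitePresentation := Algebra.FinitePresentation.of_finiteType.1 inferInstance
  formallySmooth := by
    refine Algebra.FormallySmooth.of_comp_surjective fun B _ _ I hI φ => ?_
    obtain ⟨P, hP, hPφ⟩ := (isProjFlag_of_algHom_quotient φ).exists_lift hI
    obtain ⟨x, hx⟩ := exists_symTuple_eq hP.isSymm
    let ψ : SymRing r n →ₐ[ℂ] B := MvPolynomial.aeval x
    have hψ : flagEquationsIdeal k n ≤ RingHom.ker ψ := by
      rw [flagEquationsIdeal_le_ker_iff]
      simpa [ψ, hx] using hP
    refine ⟨Ideal.Quotient.liftₐ _ ψ hψ, Ideal.Quotient.algHom_ext _ ?_⟩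
    refine MvPolynomial.algHom_ext fun ⟨i, e⟩ => ?_
    induction e with
    | _ a b =>
      have h := congrFun (congrFun (hPφ i) a) b
      rw [← hx] at h
      change Ideal.Quotient.mk I (ψ (MvPolynomial.X (i, s(a, b)))) = _
      rw [MvPolynomial.aeval_X]
      exact h

theorem theorem2p5 (r n : ℕ) (k : Fin r → ℕ) (hpos : ∀ i, 1 ≤ k i) (hk : StrictMono k)
    (hn : ∀ i, k i ≤ n) :
    Algebra.Smooth ℂ (pFlCoordRing k n) ∧
      (pFlIdeal k n).IsPrime ∧
      pFlIdeal k n = flagEquationsIdeal k n := by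
  have h := pFlIdeal_eq_flagEquationsIdeal hk.monotone hn
  unfold pFlCoordRing
  rw [h]
  exact ⟨smooth_quotient_flagEquationsIdeal k, flagEquationsIdeal_isPrime hk.monotone hn, rfl⟩
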